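/- Let $M$ be a von Neumann algebra acting on a complex Hilbert space. Assume that $M$ is separable (its predual $M_*$ is norm separable), diffuse (it has no minimal projections) and finite (every isometry in $M$ is unitary), and let $\tau$ be a normal faithful tracial state on $M$, i.e. a positive, ultraweakly continuous linear functional with $\tau(1)=1$, $\tau(xy)=\tau(yx)$ for all $x,y\in M$, and $\tau(x^*x)=0$ only for $x=0$. Let $L^2(M,\tau)$ be the Hilbert space completion of $M$ for the inner product $\langle x,y\rangle=\tau(x^*y)$, and let $\hat x\in L^2(M,\tau)$ denote the image of $x\in M$. Then $L^2(M,\tau)$ has an orthonormal basis consisting entirely of self-adjoint unitaries in $M$: there is a set $S\subset M$ such that every $u\in S$ satisfies $u=u^*$ and $u^2=1$, and $(\hat u)_{u\in S}$ is an orthonormal basis of $L^2(M,\tau)$. -/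

import Mathlib

open scoped ComplexOrder InnerProductSpace

noncomputable section

namespace VonNeumannAlgebra

variable {H : Type*} [NormedAddCommGroup H] [InnerProductSpace ℂ H] [CompleteSpace H]

/-! ### A von Neumann algebra as a C⋆-algebra, with the order inherited from `B(H)` -/

instance instSMulMemClass : SMulMemClass (VonNeumannAlgebra H) ℂ (H →L[ℂ] H) where
  smul_mem {s} r _ hm := s.toStarSubalgebra.smul_mem hm r

/-- A von Neumann algebra is norm closed in `B(H)`; this makes `StarSubalgebra.cstarAlgebra` apply,
so that `M` carries its C⋆-algebra structure. -/
instance instIsClosed (M : VonNeumannAlgebra H) : IsClosed (M : Set (H →L[ℂ] H)) :=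
  M.centralizer_centralizer ▸ Set.isClosed_centralizer _

/-- Positive elements of `M` (in the order of `B(H)`) have square roots in `M`. -/
instance instStarOrderedRing (M : VonNeumannAlgebra H) : StarOrderedRing M :=
  StarOrderedRing.of_nonneg_iff'
    (fun {x y} hxy z => by
      change ((z + x : M) : H →L[ℂ] H) ≤ ((z + y : M) : H →L[ℂ] H)
      have h : (x : H →L[ℂ] H) ≤ y := hxy
      simpa using h)
    (fun x => by
      constructor
      · intro hx
        have hx' : (0 : H →L[ℂ] H) ≤ (x : H →L[ℂ] H) := hx
        have hs : 0 ≤ CFC.sqrt (x : H →L[ℂ] H) := CFC.sqrt_nonneg _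
        have hmem : CFC.sqrt (x : H →L[ℂ] H) ∈ M := by
          rw [← SetLike.mem_coe, ← M.centralizer_centralizer]
          intro g hg
          have hc : Commute (x : H →L[ℂ] H) g := hg x x.2
          exact (hc.cfcₙ_nnreal NNReal.sqrt).symm.eq
        refine ⟨⟨_, hmem⟩, Subtype.ext ?_⟩
        change (x : H →L[ℂ] H) = star (CFC.sqrt (x : H →L[ℂ] H)) * CFC.sqrt (x : H →L[ℂ] H)
        rw [(IsSelfAdjoint.of_nonneg hs).star_eq, CFC.sqrt_mul_sqrt_self _ hx']
      · rintro ⟨s, rfl⟩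
        exact star_mul_self_nonneg (s : H →L[ℂ] H))

/-! ### Normal functionals, the predual, separability -/

/-- A linear functional on `M` is normal if it is ultraweakly (`σ`-weakly) continuous, that is, of
the form `x ↦ ∑ₙ ⟪ξₙ, x ηₙ⟫` with `∑ₙ ‖ξₙ‖² < ∞` and `∑ₙ ‖ηₙ‖² < ∞`. -/
def IsNormal (M : VonNeumannAlgebra H) (φ : M →ₗ[ℂ] ℂ) : Prop :=
  ∃ ξ η : ℕ → H, Summable (fun n => ‖ξ n‖ ^ 2) ∧ Summable (fun n => ‖η n‖ ^ 2) ∧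
    ∀ x : M, HasSum (fun n => ⟪ξ n, (x : H →L[ℂ] H) (η n)⟫_ℂ) (φ x)

/-- The predual `M_*`: the normal functionals, inside the norm dual of `M`. -/
def predual (M : VonNeumannAlgebra H) : Set (StrongDual ℂ M) :=
  {φ | M.IsNormal (φ : M →ₗ[ℂ] ℂ)}

/-- `M` is separable (as a von Neumann algebra): its predual is norm separable. -/
def HasSeparablePredual (M : VonNeumannAlgebra H) : Prop :=
  TopologicalSpace.IsSeparable M.predual

/-! ### Finite and diffuse von Neumann algebras -/

/-- `M` is finite: every isometry in `M` is unitary. -/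
def IsFiniteVN (M : VonNeumannAlgebra H) : Prop :=
  ∀ v : M, star v * v = 1 → v * star v = 1

/-- A minimal projection: a nonzero projection of `M` with no projections of `M` below it other
than zero and itself. -/
def IsMinimalProjection {M : VonNeumannAlgebra H} (p : M) : Prop :=
  IsStarProjection p ∧ p ≠ 0 ∧ ∀ q : M, IsStarProjection q → q ≤ p → q = 0 ∨ q = p

/-- `M` is diffuse: it has no minimal projections. -/
def IsDiffuse (M : VonNeumannAlgebra H) : Prop :=
  ∀ p : M, ¬ IsMinimalProjection p

/-! ### Traces -/

/-- `τ` is a (normalized) normal faithful trace on `M`. Positivity is part of its type. -/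
structure IsNormalFaithfulTrace {M : VonNeumannAlgebra H} (τ : M →ₚ[ℂ] ℂ) : Prop where
  map_one : τ 1 = 1
  map_mul_comm : ∀ x y : M, τ (x * y) = τ (y * x)
  faithful : ∀ x : M, τ (star x * x) = 0 → x = 0
  normal : M.IsNormal τ.toLinearMap

/-- `L²(M, τ)`: the Hilbert space completion of `M` for the inner product
`⟪x, y⟫ = τ (star x * y)`. -/
abbrev L2 {M : VonNeumannAlgebra H} (τ : M →ₚ[ℂ] ℂ) : Type _ := τ.GNS

/-- The canonical map `M → L²(M, τ)`, `x ↦ x̂`. -/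
def toL2 {M : VonNeumannAlgebra H} (τ : M →ₚ[ℂ] ℂ) (x : M) : L2 τ :=
  ((τ.toPreGNS x : τ.PreGNS) : UniformSpace.Completion τ.PreGNS)

end VonNeumannAlgebra

end

/-!
Self-adjoint elements span `M` over `ℂ`, so it suffices to approximate countably many self-adjoint
`x ∈ M`, the real and imaginary parts of a dense sequence in `L²(M, τ)`, by linear combinations of
pairwise orthogonal symmetries (self-adjoint unitaries), enlarging a finite family of symmetries at
every stage. A dense sequence exists because the norm separability of the predual passes to
`L²(M, τ)` (`IsNormalFaithfulTrace.exists_countable_dense`).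

The symmetries come from a noncommutative Lyapunov theorem (`IsDiffuse.exists_symmetry`): given
finitely many hermitian normal functionals and a self-adjoint contraction `x`, some symmetry `u`
takes the same values as `x` on all of them. Indeed, the self-adjoint contractions with these
values form a weakly compact convex set, which has an extreme point `y` by Krein-Milman. If
`b = 1 - y²` were nonzero, the corner `b M b` would be infinite-dimensional, since a
finite-dimensional one produces a minimal projection. It would then contain an element `b w b ≠ 0`,
with `w` a self-adjoint contraction, annihilated by the functionals, and `y ± ½ b w b` would be
contractions (`norm_add_half_conjugate_le_one`), contradicting extremality.

Now let `x` be self-adjoint with `‖x‖ ≤ K`, orthogonal to the finite family `F` chosen so far. The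
theorem, applied to `K⁻¹ x`, provides a symmetry `u` orthogonal to `F` with
`⟪x̂, û⟫ = ‖x̂‖² / K`. Adding `u` to `F` and subtracting from `x` its component along `u`
decreases `‖x̂‖`, and although the operator norm bound `K` grows, it grows slowly enough
that repeating this makes `‖x̂‖` arbitrarily small (`exists_extension_norm_lt_of_orthogonal`).
-/

/-! ### Corners of C⋆-algebras -/

section Corner

variable {A : Type*} [CStarAlgebra A]

/-- The corner `b A b`, as a linear subspace of `A`. -/
noncomputable def corner (b : A) : Submodule ℂ A :=
  LinearMap.range (LinearMap.mulLeftRight ℂ (b, b))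

theorem mem_corner {b x : A} : x ∈ corner b ↔ ∃ w, b * w * b = x := by
  simp [corner]

theorem corner_le_corner {b q g h : A} (hl : q = b * g) (hr : q = h * b) :
    corner q ≤ corner b := by
  intro x hx
  obtain ⟨w, rfl⟩ := mem_corner.1 hx
  refine mem_corner.2 ⟨g * w * h, ?_⟩
  calc b * (g * w * h) * b = (b * g) * w * (h * b) := by simp only [mul_assoc]
    _ = q * w * q := by rw [← hl, ← hr]

/-- If `b A b` is finite-dimensional, then `b p(b) b = 0` for some polynomial `p ≠ 0`, and the
spectrum of `b` consists of roots of `X p X`. -/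
theorem finite_spectrum_of_finite_corner (b : A) [FiniteDimensional ℂ (corner b)] :
    (spectrum ℂ b).Finite := by
  let L : Polynomial ℂ →ₗ[ℂ] corner b :=
    (LinearMap.mulLeftRight ℂ (b, b)).rangeRestrict ∘ₗ (Polynomial.aeval b).toLinearMap
  have hL : ¬ Function.Injective L := fun h =>
    Polynomial.not_finite (R := ℂ) (Module.Finite.of_injective L h)
  rw [← LinearMap.ker_eq_bot, Submodule.eq_bot_iff] at hL
  push Not at hL
  obtain ⟨p, hp, hp0⟩ := hL
  have hbp : Polynomial.aeval b (Polynomial.X * p * Polynomial.X) = 0 := by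
    have h : b * Polynomial.aeval b p * b = 0 := congrArg Subtype.val hp
    simpa only [map_mul, Polynomial.aeval_X] using h
  have hne : Polynomial.X * p * Polynomial.X ≠ 0 :=
    mul_ne_zero (mul_ne_zero Polynomial.X_ne_zero hp0) Polynomial.X_ne_zero
  refine (Polynomial.finite_setOfPred_isRoot hne).subset fun z hz => ?_
  have h := spectrum.subset_polynomial_aeval b (Polynomial.X * p * Polynomial.X) ⟨z, hz, rfl⟩
  rw [hbp] at h
  have : Nontrivial A := by
    by_contra hA
    rw [not_nontrivial_iff_subsingleton] at hA
    simp at hz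
  rw [spectrum.zero_eq] at h
  exact h

/-- A finite-dimensional corner `b A b` with `b ≠ 0` self-adjoint contains the corner of a nonzero
projection: the indicator function of a nonzero point of the spectrum is continuous on the
spectrum, which is finite. -/
theorem exists_isStarProjection_corner_le {b : A} (hb : IsSelfAdjoint b) (hb0 : b ≠ 0)
    [FiniteDimensional ℂ (corner b)] :
    ∃ q : A, IsStarProjection q ∧ q ≠ 0 ∧ corner q ≤ corner b := by
  have hfin : (spectrum ℝ b).Finite := by
    rw [← spectrum.preimage_algebraMap ℂ]
    exact (finite_spectrum_of_finite_corner b).preimage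
      (FaithfulSMul.algebraMap_injective ℝ ℂ).injOn
  have hcont (f : ℝ → ℝ) : ContinuousOn f (spectrum ℝ b) := hfin.continuousOn f
  obtain ⟨t, ht, ht0⟩ : ∃ t ∈ spectrum ℝ b, t ≠ 0 := by
    by_contra! h
    apply hb0
    rw [← cfc_id ℝ b, ← cfc_zero ℝ b]
    exact cfc_congr fun t ht => h t ht
  let f : ℝ → ℝ := Pi.single t 1
  have hff (s : ℝ) : f s * f s = f s := by
    by_cases hs : s = t
    · subst hs; simp [f]
    · simp [f, hs]
  refine ⟨cfc f b, ⟨?_, cfc_predicate f b⟩, fun h => ?_, ?_⟩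
  · rw [IsIdempotentElem, ← cfc_mul f f b (hcont _) (hcont _)]
    exact cfc_congr fun s _ => hff s
  · rw [← cfc_zero ℝ b] at h
    have := (cfc_eq_cfc_iff_eqOn hb (hcont _) (hcont _)).1 h ht
    simp [f] at this
  -- `f(b) = b g(b) = g(b) b` with `g(s) = s⁻¹ f(s)`; at `s = 0` both sides vanish as `t ≠ 0`
  · have hs (s : ℝ) : f s = s * (s⁻¹ * f s) := by
      by_cases h : s = t
      · subst h; field_simp
      · simp [f, h]
    have hl : cfc f b = b * cfc (fun s => s⁻¹ * f s) b := by
      calc cfc f b = cfc (fun s => s * (s⁻¹ * f s)) b := cfc_congr fun s _ => hs s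
        _ = cfc (fun s : ℝ => s) b * cfc (fun s => s⁻¹ * f s) b :=
          cfc_mul _ _ b (hcont _) (hcont _)
        _ = b * cfc (fun s => s⁻¹ * f s) b := by rw [cfc_id' ℝ b]
    have hc : Commute b (cfc (fun s => s⁻¹ * f s) b) := ((Commute.refl b).cfc_real _).symm
    exact corner_le_corner hl (hl.trans hc.eq)

variable [PartialOrder A] [StarOrderedRing A]

/-- A nonzero projection `q` with `q A q` finite-dimensional dominates a minimal projection: take
one of least dimension. -/
theorem exists_minimal_projection_of_finite_corner {q : A} (hq : IsStarProjection q) (hq0 : q ≠ 0)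
    (hfin : FiniteDimensional ℂ (corner q)) :
    ∃ p : A, IsStarProjection p ∧ p ≠ 0 ∧
      ∀ r : A, IsStarProjection r → r ≤ p → r = 0 ∨ r = p := by
  induction hn : Module.finrank ℂ (corner q) using Nat.strong_induction_on generalizing q with
  | _ n ih =>
    by_cases hmin : ∀ r : A, IsStarProjection r → r ≤ q → r = 0 ∨ r = q
    · exact ⟨q, hq, hq0, hmin⟩
    push Not at hmin
    obtain ⟨r, hr, hrq, hr0, hne⟩ := hmin
    have h1 : q * r = r := (hr.le_iff_mul_eq_right hq).1 hrq
    have h2 : r * q = r := (hr.le_iff_mul_eq_left hq).1 hrq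
    have hle : corner r ≤ corner q := corner_le_corner h1.symm h2.symm
    have hlt : corner r < corner q := by
      refine lt_of_le_of_ne hle fun h => hne ?_
      have hqr : q ∈ corner r := by
        rw [h]
        exact mem_corner.2 ⟨q, by rw [hq.isIdempotentElem.eq, hq.isIdempotentElem.eq]⟩
      obtain ⟨w, hw⟩ := mem_corner.1 hqr
      rw [← h1, ← hw, mul_assoc, hr.isIdempotentElem.eq]
    exact ih _ (hn ▸ Submodule.finrank_lt_finrank_of_lt hlt) hr hr0
      (Submodule.finiteDimensional_of_le hle) rfl

theorem IsSelfAdjoint.norm_le_one_of_le {x : A} (hx : IsSelfAdjoint x) (h1 : x ≤ 1) (h2 : -x ≤ 1) :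
    ‖x‖ ≤ 1 := by
  nontriviality A
  rcases CStarAlgebra.norm_or_neg_norm_mem_spectrum (a := x) hx with h | h
  · have := (le_algebraMap_iff_spectrum_le (r := (1 : ℝ)) (a := x)).1 (by simpa using h1)
    exact this _ h
  · have := (algebraMap_le_iff_le_spectrum (r := (-1 : ℝ)) (a := x)).1 (by simpa using neg_le.1 h2)
    linarith [this _ h]

/-- If `y` is a self-adjoint contraction and `b = 1 - y²`, then `y` remains a contraction after
adding `½ b w b`, for every self-adjoint contraction `w`. This is because
`b w b ≤ b² ≤ b` and `1 ± y - ½ b = ½ (1 ± y)²`. -/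
theorem norm_add_half_conjugate_le_one {y w : A} (hy : IsSelfAdjoint y) (hy1 : ‖y‖ ≤ 1)
    (hw : IsSelfAdjoint w) (hw1 : ‖w‖ ≤ 1) :
    ‖y + (2⁻¹ : ℝ) • ((1 - y * y) * w * (1 - y * y))‖ ≤ 1 := by
  set b := 1 - y * y with hbdef
  have hb : IsSelfAdjoint b := by simp [hbdef, IsSelfAdjoint, hy.star_eq]
  have hb0 : 0 ≤ b := by
    have h : star y * y ≤ algebraMap ℝ A (‖y‖ ^ 2) := CStarAlgebra.star_mul_le_algebraMap_norm_sq
    have h' : algebraMap ℝ A (‖y‖ ^ 2) ≤ algebraMap ℝ A 1 :=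
      algebraMap_mono A (pow_le_one₀ (norm_nonneg _) hy1)
    rw [map_one] at h'
    rw [hy.star_eq] at h
    exact sub_nonneg.2 (h.trans h')
  have hbb : b * b ≤ b := by
    have h : 0 ≤ star y * b * y := star_left_conjugate_nonneg hb0 y
    rw [hy.star_eq] at h
    rw [← sub_nonneg]
    have e : b - b * b = y * b * y := by rw [hbdef]; noncomm_ring
    rwa [e]
  have hconj (v : A) (hv : IsSelfAdjoint v) (hv1 : ‖v‖ ≤ 1) : b * v * b ≤ b := by
    have h : v ≤ 1 := hv.le_algebraMap_norm_self.trans <| by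
      simpa using algebraMap_mono A hv1
    have := star_left_conjugate_le_conjugate h b
    rw [hb.star_eq, mul_one] at this
    exact this.trans hbb
  have hkey (x v : A) (hx : IsSelfAdjoint x) (hxx : x * x = y * y) (hv : IsSelfAdjoint v)
      (hv1 : ‖v‖ ≤ 1) : x + (2⁻¹ : ℝ) • (b * v * b) ≤ 1 := by
    have h1 : (2⁻¹ : ℝ) • (b * v * b) ≤ (2⁻¹ : ℝ) • b :=
      smul_le_smul_of_nonneg_left (hconj v hv hv1) (by norm_num)
    have h2 : 0 ≤ (2⁻¹ : ℝ) • (star (1 - x) * (1 - x)) :=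
      smul_nonneg (by norm_num) (star_mul_self_nonneg _)
    have h3 : 1 - (x + (2⁻¹ : ℝ) • b) = (2⁻¹ : ℝ) • (star (1 - x) * (1 - x)) := by
      rw [star_sub, star_one, hx.star_eq, hbdef, ← hxx]
      have : (1 - x) * (1 - x) = (2 : ℝ) • (1 - x) - (1 - x * x) := by
        rw [two_smul]; noncomm_ring
      rw [this]
      module
    rw [← h3, sub_nonneg] at h2
    exact (add_le_add_right h1 x).trans h2
  refine IsSelfAdjoint.norm_le_one_of_le ?_ (hkey y w hy rfl hw hw1) ?_
  · simp [IsSelfAdjoint, hy.star_eq, hw.star_eq, hb.star_eq, mul_assoc]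
  · have := hkey (-y) (-w) hy.neg (by simp) hw.neg (by simpa using hw1)
    convert this using 1
    simp [add_comm]

end Corner

/-! ### Weak compactness of the unit ball -/

namespace VonNeumannAlgebra

variable {H : Type*} [NormedAddCommGroup H] [InnerProductSpace ℂ H] [CompleteSpace H]

theorem mem_iff_forall_commutant {M : VonNeumannAlgebra H} {x : H →L[ℂ] H} :
    x ∈ M ↔ ∀ g ∈ M.commutant, g * x = x * g := by
  conv_lhs => rw [← M.commutant_commutant]
  exact mem_commutant_iff

/-- The sesquilinear form `(ξ, η) ↦ ⟪ξ, x η⟫` of an element `x` of `M`. The topology of pointwise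
convergence on `H → H → ℂ` induces the weak operator topology on `M`. -/
noncomputable def form (M : VonNeumannAlgebra H) : M →ₗ[ℝ] (H → H → ℂ) where
  toFun x ξ η := ⟪ξ, (x : H →L[ℂ] H) η⟫_ℂ
  map_add' x y := by ext ξ η; simp
  map_smul' r x := by
    ext ξ η
    change ⟪ξ, ((r • x : M) : H →L[ℂ] H) η⟫_ℂ = r • ⟪ξ, (x : H →L[ℂ] H) η⟫_ℂ
    rw [← inner_smul_right_eq_smul]
    rfl

theorem form_apply (M : VonNeumannAlgebra H) (x : M) (ξ η : H) :
    M.form x ξ η = ⟪ξ, (x : H →L[ℂ] H) η⟫_ℂ := rfl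

theorem form_injective (M : VonNeumannAlgebra H) : Function.Injective M.form := by
  intro x y h
  refine Subtype.ext (ContinuousLinearMap.ext fun η => ext_inner_left ℂ fun ξ => ?_)
  exact congrFun (congrFun h ξ) η

theorem norm_form_le (M : VonNeumannAlgebra H) {x : M} (hx : ‖x‖ ≤ 1) (ξ η : H) :
    ‖M.form x ξ η‖ ≤ ‖ξ‖ * ‖η‖ := by
  refine (norm_inner_le_norm _ _).trans ?_
  gcongr
  exact ((x : H →L[ℂ] H).le_opNorm η).trans (mul_le_of_le_one_left (norm_nonneg _) hx)

/-- The unit ball of `M` is compact in the weak operator topology. -/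
theorem isCompact_form_image_ball (M : VonNeumannAlgebra H) :
    IsCompact (M.form '' {x | ‖x‖ ≤ 1}) := by
  have hK : IsCompact {B : H → H → ℂ | ∀ ξ η, ‖B ξ η‖ ≤ ‖ξ‖ * ‖η‖} := by
    have h := isCompact_univ_pi (fun ξ : H => isCompact_univ_pi
      (fun η : H => isCompact_closedBall (0 : ℂ) (‖ξ‖ * ‖η‖)))
    convert h using 1
    ext B
    simp [Set.mem_pi]
  have hset : M.form '' {x | ‖x‖ ≤ 1} = {B : H → H → ℂ | ∀ ξ η, ‖B ξ η‖ ≤ ‖ξ‖ * ‖η‖} ∩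
      ({B | ∀ ξ₁ ξ₂ η, B (ξ₁ + ξ₂) η = B ξ₁ η + B ξ₂ η} ∩
      {B | ∀ ξ η₁ η₂, B ξ (η₁ + η₂) = B ξ η₁ + B ξ η₂} ∩
      {B | ∀ (c : ℂ) (ξ η : H), B (c • ξ) η = star c * B ξ η} ∩
      {B | ∀ (c : ℂ) (ξ η : H), B ξ (c • η) = c * B ξ η} ∩
      {B | ∀ g ∈ M.commutant, ∀ ξ η, B (star g ξ) η = B ξ (g η)}) := by
    ext B
    constructor
    · rintro ⟨x, hx, rfl⟩
      refine ⟨M.norm_form_le hx, ⟨⟨⟨?_, ?_⟩, ?_⟩, ?_⟩, ?_⟩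
      · intro ξ₁ ξ₂ η; simp [form_apply]
      · intro ξ₁ ξ₂ η; simp [form_apply]
      · intro c ξ η; simp [form_apply, mul_comm]
      · intro c ξ η; simp [form_apply]
      · intro g hg ξ η
        have h := mem_iff_forall_commutant.1 x.2 g hg
        rw [form_apply, form_apply, ContinuousLinearMap.star_eq_adjoint,
          ContinuousLinearMap.adjoint_inner_left]
        exact congrArg _ (congrArg (fun T : H →L[ℂ] H => T η) h)
    · rintro ⟨hb, ⟨⟨⟨h1, h2⟩, h3⟩, h4⟩, h5⟩
      let S : H →L⋆[ℂ] H →L[ℂ] ℂ := LinearMap.mkContinuous₂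
        (LinearMap.mk₂'ₛₗ (starRingEnd ℂ) (RingHom.id ℂ) B h1 h3 h2 h4) 1
        (fun ξ η => by simpa using hb ξ η)
      have hS (ξ η : H) : S ξ η = B ξ η := rfl
      let T : H →L[ℂ] H :=
        ContinuousLinearMap.adjoint (InnerProductSpace.continuousLinearMapOfBilin S)
      have hT (ξ η : H) : ⟪ξ, T η⟫_ℂ = B ξ η := by
        rw [ContinuousLinearMap.adjoint_inner_right,
          InnerProductSpace.continuousLinearMapOfBilin_apply, hS]
      have hTM : T ∈ M := by
        refine mem_iff_forall_commutant.2 fun g hg => ?_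
        refine ContinuousLinearMap.ext fun η => ext_inner_left ℂ fun ξ => ?_
        change ⟪ξ, g (T η)⟫_ℂ = ⟪ξ, T (g η)⟫_ℂ
        rw [hT, ← h5 g hg, ← hT, ContinuousLinearMap.star_eq_adjoint,
          ContinuousLinearMap.adjoint_inner_left]
      refine ⟨⟨T, hTM⟩, ?_, ?_⟩
      · change ‖T‖ ≤ 1
        refine ContinuousLinearMap.opNorm_le_bound _ zero_le_one fun η => ?_
        rw [one_mul]
        rcases eq_or_lt_of_le (norm_nonneg (T η)) with h0 | h0
        · rw [← h0]; positivity
        · have h := hb (T η) η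
          rw [← hT, inner_self_eq_norm_sq_to_K, norm_pow, sq] at h
          simp only [RCLike.norm_ofReal, abs_norm] at h
          exact le_of_mul_le_mul_left h h0
      · ext ξ η
        exact hT ξ η
  rw [hset]
  have hcont (ξ η : H) : Continuous fun B : H → H → ℂ => B ξ η := by fun_prop
  refine hK.inter_right ((((IsClosed.inter ?_ ?_).inter ?_).inter ?_).inter ?_)
  all_goals simp only [Set.ofPred_forall]
  · exact isClosed_iInter fun _ => isClosed_iInter fun _ => isClosed_iInter fun _ =>
      isClosed_eq (hcont _ _) ((hcont _ _).add (hcont _ _))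
  · exact isClosed_iInter fun _ => isClosed_iInter fun _ => isClosed_iInter fun _ =>
      isClosed_eq (hcont _ _) ((hcont _ _).add (hcont _ _))
  · exact isClosed_iInter fun _ => isClosed_iInter fun _ => isClosed_iInter fun _ =>
      isClosed_eq (hcont _ _) (continuous_const.mul (hcont _ _))
  · exact isClosed_iInter fun _ => isClosed_iInter fun _ => isClosed_iInter fun _ =>
      isClosed_eq (hcont _ _) (continuous_const.mul (hcont _ _))
  · exact isClosed_iInter fun _ => isClosed_iInter fun _ => isClosed_iInter fun _ =>
      isClosed_iInter fun _ => isClosed_eq (hcont _ _) (hcont _ _)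

/-- A normal functional is weak operator continuous on the unit ball: there the series defining it
converges uniformly. -/
theorem IsNormal.exists_continuousOn {M : VonNeumannAlgebra H} {φ : M →ₗ[ℂ] ℂ}
    (hφ : M.IsNormal φ) :
    ∃ Φ : (H → H → ℂ) → ℂ, ContinuousOn Φ (M.form '' {x | ‖x‖ ≤ 1}) ∧
      ∀ x, Φ (M.form x) = φ x := by
  obtain ⟨ξ, η, hξ, hη, h⟩ := hφ
  refine ⟨fun B => ∑' n, B (ξ n) (η n), ?_, fun x => (h x).tsum_eq⟩
  refine continuousOn_tsum (u := fun n => ‖ξ n‖ * ‖η n‖) (fun n => ?_) ?_ ?_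
  · exact Continuous.continuousOn (by fun_prop)
  · refine Summable.of_nonneg_of_le (fun n => by positivity) (fun n => ?_) (hξ.add hη)
    nlinarith [sq_nonneg (‖ξ n‖ - ‖η n‖), sq_nonneg ‖ξ n‖, sq_nonneg ‖η n‖]
  · rintro n _ ⟨x, hx, rfl⟩
    exact M.norm_form_le hx _ _

/-! ### Symmetries with prescribed values of normal functionals -/

/-- In a diffuse von Neumann algebra the corner `b M b` of a nonzero self-adjoint element is
infinite-dimensional. -/
theorem IsDiffuse.not_finiteDimensional_corner {M : VonNeumannAlgebra H} (hM : M.IsDiffuse)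
    {b : M} (hb : IsSelfAdjoint b) (hb0 : b ≠ 0) : ¬ FiniteDimensional ℂ (corner b) := by
  intro hfin
  obtain ⟨q, hq, hq0, hqb⟩ := exists_isStarProjection_corner_le hb hb0
  obtain ⟨p, hp, hp0, hmin⟩ := exists_minimal_projection_of_finite_corner hq hq0
    (Submodule.finiteDimensional_of_le hqb)
  exact hM p ⟨hp, hp0, hmin⟩

/-- Finitely many hermitian functionals have a common zero of the form `b w b ≠ 0` with `w` a
self-adjoint contraction. -/
theorem IsDiffuse.exists_conjugate_mem_ker {M : VonNeumannAlgebra H} (hM : M.IsDiffuse)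
    {b : M} (hb : IsSelfAdjoint b) (hb0 : b ≠ 0) {ι : Type*} [Finite ι] (φ : ι → M →ₗ[ℂ] ℂ)
    (hφ : ∀ i x, φ i (star x) = star (φ i x)) :
    ∃ w : M, IsSelfAdjoint w ∧ ‖w‖ ≤ 1 ∧ b * w * b ≠ 0 ∧ ∀ i, φ i (b * w * b) = 0 := by
  suffices h : ∃ w : M, IsSelfAdjoint w ∧ b * w * b ≠ 0 ∧ ∀ i, φ i (b * w * b) = 0 by
    obtain ⟨w, hw, hne, h0⟩ := h
    have hw0 : w ≠ 0 := by rintro rfl; simp at hne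
    have hn : ‖w‖ ≠ 0 := norm_ne_zero_iff.2 hw0
    have hc : ((‖w‖ : ℂ)⁻¹) ≠ 0 := inv_ne_zero (by exact_mod_cast hn)
    have e : b * ((‖w‖ : ℂ)⁻¹ • w) * b = (‖w‖ : ℂ)⁻¹ • (b * w * b) := by
      rw [mul_smul_comm, smul_mul_assoc]
    refine ⟨(‖w‖ : ℂ)⁻¹ • w, ?_, ?_, ?_, fun i => ?_⟩
    · simp [IsSelfAdjoint, hw.star_eq]
    · rw [norm_smul, norm_inv, Complex.norm_real, norm_norm, inv_mul_cancel₀ hn]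
    · rw [e]; exact smul_ne_zero hc hne
    · rw [e, map_smul, h0, smul_zero]
  let L : corner b →ₗ[ℂ] (ι → ℂ) := LinearMap.pi fun i => φ i ∘ₗ (corner b).subtype
  have hL : ¬ Function.Injective L := fun h =>
    hM.not_finiteDimensional_corner hb hb0 (FiniteDimensional.of_injective L h)
  rw [← LinearMap.ker_eq_bot, Submodule.eq_bot_iff] at hL
  push Not at hL
  obtain ⟨⟨z, hz⟩, hLz, hz0⟩ := hL
  have hz0 : z ≠ 0 := fun h => hz0 (Subtype.ext h)
  have hφz (i : ι) : φ i z = 0 := congrFun (LinearMap.mem_ker.1 hLz) i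
  have hφz' (i : ι) : φ i (star z) = 0 := by rw [hφ, hφz, star_zero]
  obtain ⟨w, rfl⟩ := mem_corner.1 hz
  have hs : star (b * w * b) = b * star w * b := by simp [hb.star_eq, mul_assoc]
  have e1 : b * (w + star w) * b = b * w * b + star (b * w * b) := by
    rw [hs]; noncomm_ring
  have e2 : b * (Complex.I • (w - star w)) * b
      = Complex.I • (b * w * b - star (b * w * b)) := by
    rw [hs, mul_smul_comm, smul_mul_assoc]; congr 1; noncomm_ring
  by_cases h1 : b * (w + star w) * b = 0
  · refine ⟨Complex.I • (w - star w), ?_, fun h2 => hz0 ?_, fun i => ?_⟩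
    · simp [IsSelfAdjoint, ← smul_neg]
    · rw [e1] at h1
      rw [e2, smul_eq_zero_iff_right Complex.I_ne_zero] at h2
      have h : (2 : ℂ) • (b * w * b) = 0 := by
        rw [two_smul]
        calc _ = (b * w * b + star (b * w * b)) + (b * w * b - star (b * w * b)) := by abel
          _ = 0 := by rw [h1, h2, add_zero]
      exact (smul_eq_zero_iff_right two_ne_zero).1 h
    · rw [e2, map_smul, map_sub, hφz, hφz', sub_zero, smul_zero]
  · refine ⟨w + star w, IsSelfAdjoint.add_star_self w, h1, fun i => ?_⟩
    rw [e1, map_add, hφz, hφz', add_zero]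

/-- A noncommutative Lyapunov theorem: on a diffuse von Neumann algebra, finitely many hermitian
normal functionals take at every self-adjoint contraction the same values as at some self-adjoint
unitary. -/
theorem IsDiffuse.exists_symmetry {M : VonNeumannAlgebra H} (hM : M.IsDiffuse)
    {ι : Type*} [Finite ι] (φ : ι → M →ₗ[ℂ] ℂ) (hn : ∀ i, M.IsNormal (φ i))
    (hφ : ∀ i x, φ i (star x) = star (φ i x)) {x : M} (hx : IsSelfAdjoint x) (hx1 : ‖x‖ ≤ 1) :
    ∃ u : M, IsSelfAdjoint u ∧ u * u = 1 ∧ ∀ i, φ i u = φ i x := by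
  set C : Set M := {y | IsSelfAdjoint y ∧ ‖y‖ ≤ 1 ∧ ∀ i, φ i y = φ i x} with hC
  have hcomp : IsCompact (M.form '' C) := by
    choose Φ hΦc hΦ using fun i => (hn i).exists_continuousOn
    have hball := M.isCompact_form_image_ball
    have h1 : IsClosed {B : H → H → ℂ | ∀ ξ η, B ξ η = star (B η ξ)} := by
      simp only [Set.ofPred_forall]
      exact isClosed_iInter fun ξ => isClosed_iInter fun η =>
        isClosed_eq (by fun_prop) (by fun_prop)
    have h2 : IsClosed (M.form '' {x | ‖x‖ ≤ 1} ∩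
        ⋂ i, M.form '' {x | ‖x‖ ≤ 1} ∩ Φ i ⁻¹' {φ i x}) :=
      hball.isClosed.inter <| isClosed_iInter fun i =>
        (hΦc i).preimage_isClosed_of_isClosed hball.isClosed isClosed_singleton
    convert (hball.of_isClosed_subset h2 Set.inter_subset_left).inter_right h1 using 1
    ext B
    constructor
    · rintro ⟨y, ⟨hy, hy1, hyx⟩, rfl⟩
      refine ⟨⟨⟨y, hy1, rfl⟩, Set.mem_iInter.2 fun i => ⟨⟨y, hy1, rfl⟩, ?_⟩⟩, fun ξ η => ?_⟩
      · exact (hΦ i y).trans (hyx i)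
      · have hy' : star (y : H →L[ℂ] H) = y := congrArg Subtype.val hy.star_eq
        rw [form_apply, form_apply]
        change _ = (starRingEnd ℂ) _
        rw [inner_conj_symm]
        conv_rhs => rw [← hy', ContinuousLinearMap.star_eq_adjoint,
          ContinuousLinearMap.adjoint_inner_left]
    · rintro ⟨⟨⟨y, hy1, rfl⟩, hy⟩, hs⟩
      refine ⟨y, ⟨?_, hy1, fun i => ?_⟩, rfl⟩
      · refine M.form_injective ?_
        ext ξ η
        rw [hs ξ η, form_apply, form_apply]
        change ⟪ξ, star (y : H →L[ℂ] H) η⟫_ℂ = (starRingEnd ℂ) _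
        rw [inner_conj_symm, ContinuousLinearMap.star_eq_adjoint,
          ContinuousLinearMap.adjoint_inner_right]
      · exact (hΦ i y).symm.trans (Set.mem_iInter.1 hy i).2
  obtain ⟨B, ⟨y, ⟨hy, hy1, hyx⟩, rfl⟩, hext⟩ :=
    hcomp.extremePoints_nonempty ⟨_, x, ⟨hx, hx1, fun _ => rfl⟩, rfl⟩
  refine ⟨y, hy, ?_, hyx⟩
  by_contra hne
  -- otherwise `y` is the midpoint of `y ± ½ b w b`, where `b = 1 - y²`
  have hb : IsSelfAdjoint (1 - y * y) := by simp [IsSelfAdjoint, hy.star_eq]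
  obtain ⟨w, hw, hw1, hw0, hwφ⟩ :=
    hM.exists_conjugate_mem_ker hb (sub_ne_zero.2 (Ne.symm hne)) φ hφ
  set z : M := (2⁻¹ : ℝ) • ((1 - y * y) * w * (1 - y * y)) with hz
  have hz0 : z ≠ 0 := smul_ne_zero (by norm_num) hw0
  have hzs : IsSelfAdjoint z := by simp [hz, IsSelfAdjoint, hy.star_eq, hw.star_eq, mul_assoc]
  have hzφ (i : ι) : φ i z = 0 := by
    rw [hz, ← Complex.coe_smul, map_smul, hwφ, smul_zero]
  have hp : y + z ∈ C :=
    ⟨hy.add hzs, norm_add_half_conjugate_le_one hy hy1 hw hw1, fun i => by simp [hzφ, hyx]⟩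
  have hm : y - z ∈ C := by
    refine ⟨hy.sub hzs, ?_, fun i => by simp [hzφ, hyx]⟩
    have := norm_add_half_conjugate_le_one hy hy1 hw.neg (by simpa using hw1)
    simpa [hz, ← sub_eq_add_neg] using this
  have h := hext ⟨_, hp, rfl⟩ ⟨_, hm, rfl⟩ <| by
    refine ⟨2⁻¹, 2⁻¹, by norm_num, by norm_num, by norm_num, ?_⟩
    rw [← map_smul, ← map_smul, ← map_add]
    congr 1
    module
  exact hz0 (by simpa using M.form_injective h)

end VonNeumannAlgebra

/-! ### The space `L²(M, τ)` -/

namespace VonNeumannAlgebra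

variable {H : Type*} [NormedAddCommGroup H] [InnerProductSpace ℂ H] [CompleteSpace H]
  {M : VonNeumannAlgebra H} {τ : M →ₚ[ℂ] ℂ}

/-- The map `x ↦ x̂` as a linear map. -/
noncomputable def toL2Linear (τ : M →ₚ[ℂ] ℂ) : M →ₗ[ℂ] L2 τ :=
  UniformSpace.Completion.toComplₗᵢ.toLinearMap ∘ₗ τ.toPreGNS.toLinearMap

theorem toL2Linear_apply (x : M) : toL2Linear τ x = toL2 τ x := rfl

theorem inner_toL2 (x y : M) : ⟪toL2 τ x, toL2 τ y⟫_ℂ = τ (star x * y) :=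
  UniformSpace.Completion.inner_coe _ _

theorem norm_toL2_sq (x : M) : ((‖toL2 τ x‖ ^ 2 : ℝ) : ℂ) = τ (star x * x) := by
  rw [← inner_toL2, inner_self_eq_norm_sq_to_K]; norm_cast

theorem denseRange_toL2 (τ : M →ₚ[ℂ] ℂ) : DenseRange (toL2 τ) :=
  UniformSpace.Completion.denseRange_coe (α := τ.PreGNS)

namespace IsNormalFaithfulTrace

theorem isNormal_mul_left (hτ : IsNormalFaithfulTrace τ) (y : M) :
    M.IsNormal (τ.toLinearMap ∘ₗ LinearMap.mulLeft ℂ y) := by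
  obtain ⟨ξ, η, hξ, hη, h⟩ := hτ.normal
  refine ⟨fun n => star (y : H →L[ℂ] H) (ξ n), η, ?_, hη, fun x => ?_⟩
  · refine Summable.of_nonneg_of_le (fun n => by positivity) (fun n => ?_)
      (hξ.mul_left (‖star (y : H →L[ℂ] H)‖ ^ 2))
    rw [← mul_pow]
    exact pow_le_pow_left₀ (norm_nonneg _) (ContinuousLinearMap.le_opNorm _ _) 2
  · have e (n : ℕ) : ⟪star (y : H →L[ℂ] H) (ξ n), (x : H →L[ℂ] H) (η n)⟫_ℂ
        = ⟪ξ n, ((y * x : M) : H →L[ℂ] H) (η n)⟫_ℂ := by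
      rw [ContinuousLinearMap.star_eq_adjoint, ContinuousLinearMap.adjoint_inner_left]
      rfl
    simp only [e]
    exact h (y * x)

theorem star_map_mul (hτ : IsNormalFaithfulTrace τ) {v x : M}
    (hv : IsSelfAdjoint v) : τ (v * star x) = star (τ (v * x)) := by
  rw [← map_star, star_mul, hv.star_eq, hτ.map_mul_comm]

/-- The Hilbert space `L²(M, τ)` is separable. The functionals `τ (y* ·)` form a separable set, and
`‖ŷ‖² ≤ ‖τ (y* ·)‖ ‖y‖`, so that on balls of `M` the norm of the predual controls that of `L²`. -/
theorem exists_countable_dense (hτ : IsNormalFaithfulTrace τ)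
    (hsep : M.HasSeparablePredual) :
    ∃ D : Set M, D.Countable ∧ Dense (toL2 τ '' D) := by
  obtain ⟨K, hK⟩ := τ.exists_norm_apply_le
  let ω (y : M) : StrongDual ℂ M :=
    (τ.toLinearMap ∘ₗ LinearMap.mulLeft ℂ (star y)).mkContinuous (K * ‖star y‖) fun x => by
      rw [mul_assoc]
      exact (hK _).trans (by gcongr; exact norm_mul_le _ _)
  have hω (y x : M) : ω y x = τ (star y * x) := rfl
  have hωp (y : M) : ω y ∈ M.predual := hτ.isNormal_mul_left (star y)
  have hball (n : ℕ) : ∃ c : Set M, c.Countable ∧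
      toL2 τ '' {x | ‖x‖ ≤ n} ⊆ closure (toL2 τ '' c) := by
    have hs : TopologicalSpace.IsSeparable (ω '' {x | ‖x‖ ≤ n}) :=
      TopologicalSpace.IsSeparable.mono hsep (by rintro _ ⟨y, -, rfl⟩; exact hωp y)
    obtain ⟨t, ht, htc, hst⟩ := hs.exists_countable_dense_subset
    obtain ⟨c, hcs, hct⟩ := Set.SurjOn.exists_bijOn_subset (f := ω) (s := {x | ‖x‖ ≤ n}) ht
    refine ⟨c, ?_, ?_⟩
    · exact (Set.countable_of_injective_of_countable_image hct.injOn (by rwa [hct.image_eq]))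
    · rintro _ ⟨x, hx, rfl⟩
      rw [Metric.mem_closure_iff]
      intro ε hε
      obtain ⟨_, hy, hxy⟩ := Metric.mem_closure_iff.1 (hst ⟨x, hx, rfl⟩)
        (ε ^ 2 / (2 * n + 1)) (by positivity)
      rw [← hct.image_eq] at hy
      obtain ⟨y, hyc, rfl⟩ := hy
      refine ⟨_, ⟨y, hyc, rfl⟩, ?_⟩
      have hyn : ‖y‖ ≤ n := hcs hyc
      have hxn : ‖x‖ ≤ n := hx
      rw [dist_eq_norm] at hxy ⊢
      have hsub : toL2 τ x - toL2 τ y = toL2 τ (x - y) := (map_sub (toL2Linear τ) x y).symm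
      rw [hsub]
      have h1 : ‖toL2 τ (x - y)‖ ^ 2 ≤ ‖ω x - ω y‖ * ‖x - y‖ := by
        have h := (ω x - ω y).le_opNorm (x - y)
        have h' : (ω x - ω y) (x - y) = ((‖toL2 τ (x - y)‖ ^ 2 : ℝ) : ℂ) := by
          rw [norm_toL2_sq, sub_apply, hω, hω, ← map_sub, ← sub_mul, star_sub]
        rw [h', Complex.norm_real, Real.norm_of_nonneg (by positivity)] at h
        exact h
      have h2 : ‖x - y‖ ≤ 2 * n + 1 := (norm_sub_le x y).trans (by linarith)
      rw [lt_div_iff₀ (by positivity)] at hxy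
      refine lt_of_pow_lt_pow_left₀ 2 hε.le (h1.trans_lt (lt_of_le_of_lt ?_ hxy))
      gcongr
  choose c hc hcd using hball
  refine ⟨⋃ n, c n, Set.countable_iUnion hc, ?_⟩
  refine dense_iff_closure_eq.2 (Set.eq_univ_of_univ_subset ?_)
  rw [← (denseRange_toL2 τ).closure_range]
  refine closure_minimal ?_ isClosed_closure
  rintro _ ⟨x, rfl⟩
  obtain ⟨n, hn⟩ := exists_nat_ge ‖x‖
  exact closure_mono (Set.image_mono (Set.subset_iUnion c n)) (hcd n ⟨x, hn, rfl⟩)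

end IsNormalFaithfulTrace

/-! ### Orthonormal families of symmetries -/

/-- A set of self-adjoint unitaries which are pairwise orthogonal for the inner product
`⟪u, v⟫ = τ (u v)`. -/
structure IsOrthogonalSymmetries (τ : M →ₚ[ℂ] ℂ) (S : Set M) : Prop where
  isSelfAdjoint : ∀ u ∈ S, IsSelfAdjoint u
  mul_self : ∀ u ∈ S, u * u = 1
  pairwise : S.Pairwise fun u v => τ (u * v) = 0

theorem IsOrthogonalSymmetries.insert {S : Set M} (hS : IsOrthogonalSymmetries τ S)
    (hτ : IsNormalFaithfulTrace τ) {u : M} (hu : IsSelfAdjoint u) (huu : u * u = 1)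
    (huS : ∀ v ∈ S, τ (v * u) = 0) : IsOrthogonalSymmetries τ (Insert.insert u S) where
  isSelfAdjoint v hv := by
    rcases hv with rfl | hv
    exacts [hu, hS.isSelfAdjoint v hv]
  mul_self v hv := by
    rcases hv with rfl | hv
    exacts [huu, hS.mul_self v hv]
  pairwise := hS.pairwise.insert fun v hv _ =>
    ⟨(hτ.map_mul_comm u v).trans (huS v hv), huS v hv⟩

theorem IsOrthogonalSymmetries.iUnion {F : ℕ → Set M} (hF : ∀ n, IsOrthogonalSymmetries τ (F n))
    (hmono : Monotone F) : IsOrthogonalSymmetries τ (⋃ n, F n) where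
  isSelfAdjoint u hu := by
    obtain ⟨n, hn⟩ := Set.mem_iUnion.1 hu
    exact (hF n).isSelfAdjoint u hn
  mul_self u hu := by
    obtain ⟨n, hn⟩ := Set.mem_iUnion.1 hu
    exact (hF n).mul_self u hn
  pairwise := (Set.pairwise_iUnion hmono.directed_le).2 fun n => (hF n).pairwise

theorem norm_toL2_of_mul_self (hτ : IsNormalFaithfulTrace τ) {u : M} (hu : IsSelfAdjoint u)
    (huu : u * u = 1) : ‖toL2 τ u‖ = 1 := by
  have h := norm_toL2_sq (τ := τ) u
  rw [hu.star_eq, huu, hτ.map_one] at h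
  have h' : ‖toL2 τ u‖ ^ 2 = 1 := by exact_mod_cast h
  exact (pow_eq_one_iff_of_nonneg (norm_nonneg _) two_ne_zero).1 h'

theorem IsOrthogonalSymmetries.orthonormal {S : Set M} (hS : IsOrthogonalSymmetries τ S)
    (hτ : IsNormalFaithfulTrace τ) : Orthonormal ℂ fun u : S => toL2 τ (u : M) := by
  refine ⟨fun u => norm_toL2_of_mul_self hτ (hS.isSelfAdjoint u u.2) (hS.mul_self u u.2),
    fun u v huv => ?_⟩
  change ⟪toL2 τ (u : M), toL2 τ (v : M)⟫_ℂ = 0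
  rw [inner_toL2, (hS.isSelfAdjoint u u.2).star_eq]
  exact hS.pairwise u.2 v.2 fun h => huv (Subtype.ext h)

/-! ### Approximation by spans of symmetries -/

/-- One step of the approximation. A self-adjoint `x` with `‖x‖ ≤ K`, orthogonal to a finite
family `F` of symmetries, has inner product `‖x̂‖² / K` with a symmetry `u` orthogonal to `F`:
Lyapunov's theorem lets `u` take the values of `K⁻¹ x` at `τ (x ·)` and at `τ (v ·)`, `v ∈ F`. -/
theorem exists_symmetry_orthogonal (hM : M.IsDiffuse) (hτ : IsNormalFaithfulTrace τ) {F : Set M}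
    (hFfin : F.Finite) (hF : IsOrthogonalSymmetries τ F) {x : M} (hx : IsSelfAdjoint x)
    (hxF : ∀ v ∈ F, τ (v * x) = 0) {K : ℝ} (hK : 0 < K) (hxK : ‖x‖ ≤ K) :
    ∃ u : M, IsSelfAdjoint u ∧ u * u = 1 ∧ (∀ v ∈ F, τ (v * u) = 0) ∧
      τ (x * u) = ((‖toL2 τ x‖ ^ 2 / K : ℝ) : ℂ) := by
  have hsa : ∀ v ∈ insert x F, IsSelfAdjoint v := by
    rintro v (rfl | hv)
    exacts [hx, hF.isSelfAdjoint v hv]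
  have := (hFfin.insert x).to_subtype
  have hKx : IsSelfAdjoint (((K⁻¹ : ℝ) : ℂ) • x) := by simp [IsSelfAdjoint, hx.star_eq]
  have hKx1 : ‖((K⁻¹ : ℝ) : ℂ) • x‖ ≤ 1 := by
    rw [norm_smul, Complex.norm_real, Real.norm_of_nonneg (by positivity), inv_mul_le_iff₀ hK]
    simpa using hxK
  obtain ⟨u, hu, huu, h⟩ := hM.exists_symmetry
    (fun v : ↥(insert x F) => τ.toLinearMap ∘ₗ LinearMap.mulLeft ℂ (v : M))
    (fun v => hτ.isNormal_mul_left _) (fun v y => hτ.star_map_mul (hsa v v.2)) hKx hKx1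
  have h' (v : M) (hv : v ∈ insert x F) : τ (v * u) = ((K⁻¹ : ℝ) : ℂ) * τ (v * x) := by
    have := h ⟨v, hv⟩
    simp only [LinearMap.comp_apply, LinearMap.mulLeft_apply, mul_smul_comm] at this
    rw [map_smul] at this
    exact this
  refine ⟨u, hu, huu, fun v hv => ?_, ?_⟩
  · rw [h' v (Or.inr hv), hxF v hv, mul_zero]
  · have hxx := norm_toL2_sq (τ := τ) x
    rw [hx.star_eq] at hxx
    rw [h' x (Or.inl rfl), ← hxx, ← Complex.ofReal_mul, div_eq_inv_mul]

/-- A self-adjoint element orthogonal to a finite orthogonal family of symmetries lies at squared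
distance less than `ε` from the span of some larger finite family. Repeatedly subtract
from `x` its component along the symmetry `u` of `exists_symmetry_orthogonal`. With `a = ‖x̂‖²` and
`K ≥ ‖x‖` this replaces `a` by `a - a² / K²` and `K` by `K + a / K`; the product `K a` does not
increase. Hence, as long as `a` stays above `ε`, the bound `K` stays bounded and `a` decreases by a
fixed amount. -/
theorem exists_extension_norm_lt_of_orthogonal (hM : M.IsDiffuse) (hτ : IsNormalFaithfulTrace τ)
    {F : Set M} (hFfin : F.Finite) (hF : IsOrthogonalSymmetries τ F) {x : M}
    (hx : IsSelfAdjoint x) (hxF : ∀ v ∈ F, τ (v * x) = 0) {ε : ℝ} (hε : 0 < ε) :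
    ∃ F' : Set M, F ⊆ F' ∧ F'.Finite ∧ IsOrthogonalSymmetries τ F' ∧
      ∃ y ∈ Submodule.span ℂ F', ‖toL2 τ (x - y)‖ ^ 2 < ε := by
  by_contra! hcon
  -- `+ 1` only makes `K₀` positive
  set K₀ : ℝ := ‖x‖ + 1 with hK₀
  have hK₀pos : 0 < K₀ := by positivity
  set a₀ : ℝ := ‖toL2 τ x‖ ^ 2 with ha₀
  have ha₀ε : ε ≤ a₀ := by
    simpa using hcon F subset_rfl hFfin hF 0 (zero_mem _)
  set C : ℝ := K₀ * a₀ with hC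
  have hCpos : 0 < C := mul_pos hK₀pos (hε.trans_le ha₀ε)
  set δ : ℝ := (ε ^ 2 / C) ^ 2 with hδ
  have hδpos : 0 < δ := by positivity
  have key (n : ℕ) : ∃ F' : Set M, F ⊆ F' ∧ F'.Finite ∧ IsOrthogonalSymmetries τ F' ∧
      ∃ y ∈ Submodule.span ℂ F', IsSelfAdjoint (x - y) ∧ (∀ v ∈ F', τ (v * (x - y)) = 0) ∧
        ∃ K : ℝ, 0 < K ∧ ‖x - y‖ ≤ K ∧ K * ‖toL2 τ (x - y)‖ ^ 2 ≤ C ∧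
          ‖toL2 τ (x - y)‖ ^ 2 ≤ a₀ - n * δ := by
    induction n with
    | zero =>
      exact ⟨F, subset_rfl, hFfin, hF, 0, zero_mem _, by simpa using hx, by simpa using hxF, K₀,
        hK₀pos, by simp [hK₀], by simp [hC, ha₀], by simp [ha₀]⟩
    | succ n ih =>
      obtain ⟨F', hFF', hfin, hF', y, hy, hxy, horth, K, hK, hxyK, hKC, ha⟩ := ih
      obtain ⟨u, hu, huu, huF, hux⟩ := exists_symmetry_orthogonal hM hτ hfin hF' hxy horth hK hxyK
      have haε := hcon F' hFF' hfin hF' y hy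
      set z := x - y with hz
      set a := ‖toL2 τ z‖ ^ 2 with haz
      have ha0 : 0 < a := hε.trans_le haε
      set t : ℝ := a / K with ht
      have ht0 : 0 < t := div_pos ha0 hK
      have hnu : ‖toL2 τ u‖ = 1 := norm_toL2_of_mul_self hτ hu huu
      have hsub : x - (y + (t : ℂ) • u) = z - (t : ℂ) • u := by rw [hz]; abel
      have hnew : ‖toL2 τ (z - (t : ℂ) • u)‖ ^ 2 = a - t ^ 2 := by
        have e : toL2 τ (z - (t : ℂ) • u) = toL2 τ z - (t : ℂ) • toL2 τ u := by
          simp only [← toL2Linear_apply, map_sub, map_smul]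
        rw [e, @norm_sub_sq ℂ, inner_smul_right, inner_toL2, hxy.star_eq, hux, norm_smul, hnu,
          ← Complex.ofReal_mul, Complex.norm_real, mul_one, Real.norm_of_nonneg ht0.le]
        simp only [RCLike.re_to_complex, Complex.ofReal_re]
        ring
      have hKε : K ≤ C / ε := by
        rw [le_div_iff₀ hε]
        exact (mul_le_mul_of_nonneg_left haε hK.le).trans hKC
      have hδt : δ ≤ t ^ 2 := by
        refine pow_le_pow_left₀ (by positivity) ?_ 2
        rw [ht, div_le_div_iff₀ hCpos hK]
        calc ε ^ 2 * K ≤ ε ^ 2 * (C / ε) := by gcongr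
          _ = ε * C := by field_simp
          _ ≤ a * C := by gcongr
      refine ⟨insert u F', hFF'.trans (Set.subset_insert _ _), hfin.insert u,
        hF'.insert hτ hu huu huF, y + (t : ℂ) • u, ?_, ?_, ?_, K + t, by positivity, ?_, ?_, ?_⟩
      · exact add_mem (Submodule.span_mono (Set.subset_insert _ _) hy)
          (Submodule.smul_mem _ _ (Submodule.subset_span (Set.mem_insert _ _)))
      · rw [hsub]
        simp [IsSelfAdjoint, hxy.star_eq, hu.star_eq]
      · rw [hsub]
        rintro v (rfl | hv)
        · rw [mul_sub, mul_smul_comm, map_sub, map_smul, huu, hτ.map_one, hτ.map_mul_comm, hux]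
          simp [ht]
        · rw [mul_sub, mul_smul_comm, map_sub, map_smul, horth v hv, huF v hv]
          simp
      · rw [hsub]
        have h1 : ‖u‖ ≤ 1 := by
          have : ‖u‖ * ‖u‖ = ‖(1 : M)‖ := by
            rw [← CStarRing.norm_star_mul_self, hu.star_eq, huu]
          have h2 : ‖(1 : M)‖ ≤ 1 := ContinuousLinearMap.norm_id_le
          nlinarith [norm_nonneg u]
        refine (norm_sub_le _ _).trans (add_le_add hxyK ?_)
        rw [norm_smul, Complex.norm_real, Real.norm_of_nonneg ht0.le]
        exact mul_le_of_le_one_right ht0.le h1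
      · rw [hsub, hnew]
        have hKt : K * t = a := by rw [ht]; field_simp
        have : (K + t) * (a - t ^ 2) = K * a - t ^ 3 := by
          rw [← hKt]; ring
        rw [this]
        have : 0 < t ^ 3 := by positivity
        linarith
      · rw [hsub, hnew]
        push_cast
        linarith
  obtain ⟨n, hn⟩ := exists_nat_gt (a₀ / δ)
  rw [div_lt_iff₀ hδpos] at hn
  obtain ⟨F', -, -, -, y, -, -, -, K, -, -, -, h⟩ := key n
  linarith [sq_nonneg ‖toL2 τ (x - y)‖]

/-- A finite orthogonal family of symmetries extends to a finite one whose span comes within `ε`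
of a given self-adjoint element. -/
theorem exists_extension_norm_lt (hM : M.IsDiffuse) (hτ : IsNormalFaithfulTrace τ)
    {F : Set M} (hFfin : F.Finite) (hF : IsOrthogonalSymmetries τ F) {x : M}
    (hx : IsSelfAdjoint x) {ε : ℝ} (hε : 0 < ε) :
    ∃ F' : Set M, F ⊆ F' ∧ F'.Finite ∧ IsOrthogonalSymmetries τ F' ∧
      ∃ y ∈ Submodule.span ℂ F', ‖toL2 τ (x - y)‖ < ε := by
  set y₀ : M := ∑ v ∈ hFfin.toFinset, τ (v * x) • v with hy₀
  have hy₀F : y₀ ∈ Submodule.span ℂ F := Submodule.sum_mem _ fun v hv =>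
    Submodule.smul_mem _ _ (Submodule.subset_span (hFfin.mem_toFinset.1 hv))
  have hy₀s : IsSelfAdjoint y₀ := by
    refine isSelfAdjoint_sum _ fun v hv => ?_
    have hv' := hF.isSelfAdjoint v (hFfin.mem_toFinset.1 hv)
    rw [IsSelfAdjoint, star_smul, hv'.star_eq, ← hτ.star_map_mul hv', hx.star_eq]
  have horth : ∀ v ∈ F, τ (v * (x - y₀)) = 0 := by
    intro v hv
    have h : τ (v * y₀) = τ (v * x) := by
      rw [hy₀, Finset.mul_sum, map_sum, Finset.sum_eq_single v]
      · rw [mul_smul_comm, map_smul, hF.mul_self v hv, hτ.map_one, smul_eq_mul, mul_one]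
      · intro w hw hwv
        rw [mul_smul_comm, map_smul, hF.pairwise hv (hFfin.mem_toFinset.1 hw) hwv.symm, smul_zero]
      · exact fun h => absurd (hFfin.mem_toFinset.2 hv) h
    rw [mul_sub, map_sub, h, sub_self]
  obtain ⟨F', hFF', hfin, hF', y, hy, hlt⟩ :=
    exists_extension_norm_lt_of_orthogonal hM hτ hFfin hF (hx.sub hy₀s) horth (pow_pos hε 2)
  refine ⟨F', hFF', hfin, hF', y₀ + y, add_mem (Submodule.span_mono hFF' hy₀F) hy, ?_⟩
  rw [← sub_sub]
  exact lt_of_pow_lt_pow_left₀ 2 hε.le hlt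

/-- For a sequence of self-adjoint elements there is an orthogonal family of symmetries whose
closed span in `L²(M, τ)` contains all of them. -/
theorem exists_orthogonalSymmetries_mem_closure (hM : M.IsDiffuse) (hτ : IsNormalFaithfulTrace τ)
    {E : Set M} (hE : E.Countable) (hEs : ∀ x ∈ E, IsSelfAdjoint x) :
    ∃ S : Set M, IsOrthogonalSymmetries τ S ∧ ∀ x ∈ E,
      toL2 τ x ∈ (Submodule.span ℂ (Set.range fun u : S => toL2 τ (u : M))).topologicalClosure := by
  rcases E.eq_empty_or_nonempty with rfl | hne
  · exact ⟨∅, ⟨by simp, by simp, by simp⟩, by simp⟩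
  -- every `x ∈ E` has to be approximated up to `1 / (m + 1)` for all `m`
  obtain ⟨f, hf⟩ := (hE.prod (Set.countable_univ (α := ℕ))).exists_eq_range
    (hne.prod Set.univ_nonempty)
  have hfs (n : ℕ) : IsSelfAdjoint (f n).1 := hEs _ (hf ▸ Set.mem_range_self n : f n ∈ E ×ˢ _).1
  let G : Type _ := {F : Set M // F.Finite ∧ IsOrthogonalSymmetries τ F}
  have hstep (n : ℕ) (F : G) : ∃ F' : G, F.1 ⊆ F'.1 ∧ ∃ y ∈ Submodule.span ℂ F'.1,
      ‖toL2 τ ((f n).1 - y)‖ < 1 / ((f n).2 + 1 : ℝ) := by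
    obtain ⟨F', h1, h2, h3, h4⟩ := exists_extension_norm_lt hM hτ F.2.1 F.2.2 (hfs n)
      (ε := 1 / ((f n).2 + 1 : ℝ)) (by positivity)
    exact ⟨⟨F', h2, h3⟩, h1, h4⟩
  choose next hsub happrox using hstep
  let F : ℕ → G := fun n => Nat.rec ⟨∅, Set.finite_empty, ⟨by simp, by simp, by simp⟩⟩ next n
  have hmono : Monotone fun n => (F n).1 := monotone_nat_of_le_succ fun n => hsub n (F n)
  refine ⟨⋃ n, (F n).1, IsOrthogonalSymmetries.iUnion (fun n => (F n).2.2) hmono, fun x hx => ?_⟩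
  refine Metric.mem_closure_iff.2 fun ε hε => ?_
  obtain ⟨m, hm⟩ := exists_nat_one_div_lt hε
  obtain ⟨n, hn⟩ : (x, m) ∈ Set.range f := hf ▸ ⟨hx, Set.mem_univ m⟩
  obtain ⟨y, hy, hlt⟩ := happrox n (F n)
  rw [hn] at hlt
  refine ⟨toL2 τ y, ?_, ?_⟩
  · have h : toL2Linear τ y ∈ (Submodule.span ℂ (F (n + 1)).1).map (toL2Linear τ) :=
      Submodule.mem_map_of_mem hy
    rw [Submodule.map_span] at h
    refine Submodule.span_mono ?_ h
    rintro _ ⟨u, hu, rfl⟩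
    exact ⟨⟨u, Set.mem_iUnion.2 ⟨n + 1, hu⟩⟩, rfl⟩
  · rw [dist_eq_norm]
    have e : toL2 τ x - toL2 τ y = toL2 τ (x - y) := (map_sub (toL2Linear τ) x y).symm
    rw [e]
    exact hlt.trans hm

end VonNeumannAlgebra

/-! ### The orthonormal basis -/

theorem theorem1 {H : Type*} [NormedAddCommGroup H] [InnerProductSpace ℂ H] [CompleteSpace H]
    (M : VonNeumannAlgebra H) (hsep : M.HasSeparablePredual) (hdiff : M.IsDiffuse)
    (hfin : M.IsFiniteVN) (τ : M →ₚ[ℂ] ℂ) (hτ : VonNeumannAlgebra.IsNormalFaithfulTrace τ) :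
    ∃ S : Set M, (∀ u ∈ S, IsSelfAdjoint u ∧ u ∈ unitary M) ∧
      ∃ b : HilbertBasis S ℂ (VonNeumannAlgebra.L2 τ),
        ∀ u : S, b u = VonNeumannAlgebra.toL2 τ (u : M) := by
  obtain ⟨D, hD, hDd⟩ := hτ.exists_countable_dense hsep
  obtain ⟨S, hS, hcl⟩ := VonNeumannAlgebra.exists_orthogonalSymmetries_mem_closure hdiff hτ
    (E := (fun x => (realPart x : M)) '' D ∪ (fun x => (imaginaryPart x : M)) '' D)
    ((hD.image _).union (hD.image _))
    (by rintro _ (⟨x, -, rfl⟩ | ⟨x, -, rfl⟩) <;> exact Subtype.prop _)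
  refine ⟨S, fun u hu => ⟨hS.isSelfAdjoint u hu, ?_⟩, ?_⟩
  · rw [Unitary.mem_iff, (hS.isSelfAdjoint u hu).star_eq]
    exact ⟨hS.mul_self u hu, hS.mul_self u hu⟩
  have htop : ⊤ ≤ (Submodule.span ℂ
      (Set.range fun u : S => VonNeumannAlgebra.toL2 τ (u : M))).topologicalClosure := by
    intro ξ _
    refine closure_minimal ?_ (Submodule.isClosed_topologicalClosure _) (hDd ξ)
    rintro _ ⟨x, hx, rfl⟩
    have e : VonNeumannAlgebra.toL2 τ x = VonNeumannAlgebra.toL2 τ (realPart x : M)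
        + Complex.I • VonNeumannAlgebra.toL2 τ (imaginaryPart x : M) := by
      conv_lhs => rw [← realPart_add_I_smul_imaginaryPart x]
      simp only [← VonNeumannAlgebra.toL2Linear_apply, map_add, map_smul]
    rw [e]
    exact add_mem (hcl _ (Or.inl ⟨x, hx, rfl⟩))
      (Submodule.smul_mem _ _ (hcl _ (Or.inr ⟨x, hx, rfl⟩)))
  exact ⟨HilbertBasis.mk (hS.orthonormal hτ) htop, fun u => by rw [HilbertBasis.coe_mk]⟩
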